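/- Let $M$ be a monoid. An atom of $M$ is an element $a\neq 1$ such that $a=bc$ implies $b=1$ or $c=1$, and $\|a\|$ denotes the supremum of the lengths of all expressions of $a\in M$ as a product of atoms; $M$ is atomic if it is generated by its atoms and $\|a\|<\infty$ for all $a\in M$. Write $a\le_L b$ (resp. $a\le_R b$) if $ac=b$ (resp. $ca=b$) for some $c\in M$. An element $\Delta\in M$ is a Garside element if, for every $a\in M$, $a\le_L\Delta$ if and only if $a\le_R\Delta$, and the set $\{a\in M: a\le_L\Delta\}$ generates $M$. A Garside monoid is a finitely generated, left and right cancellative atomic monoid that has a Garside element and for which $(M,\le_L)$ and $(M,\le_R)$ are lattices. A Garside group $G$ is the group of fractions of a Garside monoid, which is identified with its image $G^+\subset G$; for $g,h\in G$ write $g\le_L h$ if $gc=h$ for some $c\in G^+$. Let $G$ be a Garside group with positive monoid $G^+$ and Garside element $\Delta\neq 1$, and let $N=\|\Delta\|$. For $g\in G$ put $$\inf(g)=\max\{r\in\mathbb Z:\Delta^r\le_L g\},\quad \sup(g)=\min\{s\in\mathbb Z: g\le_L\Delta^s\},\quad \operatorname{len}(g)=\sup(g)-\inf(g),$$ $$\textstyle\inf_s(g)=\max\{\inf(h):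 h \text{ conjugate to } g\},\quad \sup_s(g)=\min\{\sup(h): h\text{ conjugate to } g\},\quad \operatorname{len}_s(g)=\sup_s(g)-\inf_s(g),$$ $$t_{\inf}(g)=\lim_{n\to\infty}\frac{\inf(g^n)}n,\quad t_{\sup}(g)=\lim_{n\to\infty}\frac{\sup(g^n)}n,\quad t_{\operatorname{len}}(g)=\lim_{n\to\infty}\frac{\operatorname{len}(g^n)}n .$$ Then, for every $g\in G$, these maxima, minima and limits exist, and (i) $\inf_s(g)\le t_{\inf}(g)\le \inf_s(g)+1-\frac1N$; (ii) $\sup_s(g)-1+\frac1N\le t_{\sup}(g)\le\sup_s(g)$; (iii) $\operatorname{len}_s(g)-2+\frac2N\le t_{\operatorname{len}}(g)\le\operatorname{len}_s(g)$. Moreover, the upper bound in (i) is optimal: for every integer $N\ge 2$ there are a Garside group $G$ with a Garside element $\Delta$ such that $\|\Delta\|=N$, and an element $g\in G$, such that $t_{\inf}(g)=\inf_s(g)+1-\frac1N$. -/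

import Mathlib

open Filter Topology

namespace Garside

section Monoids

variable {M : Type*} [Monoid M]

/-- Atoms: the elements `a ≠ 1` such that `a = b * c` implies `b = 1` or `c = 1`. -/
def IsAtomElt (a : M) : Prop :=
  a ≠ 1 ∧ ∀ b c : M, a = b * c → b = 1 ∨ c = 1

/-- `‖a‖`: the supremum (in `ℕ ∪ {∞}`) of the lengths of all expressions of `a` as a product
of atoms. The empty product is an expression of `1`. -/
noncomputable def atomNorm (a : M) : ℕ∞ :=
  ⨆ (l : List M) (_ : (∀ x ∈ l, IsAtomElt x) ∧ l.prod = a), (l.length : ℕ∞)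

/-- The order `a ≤_L b` of a monoid: `a * c = b` for some `c`. -/
def MLeL (a b : M) : Prop := ∃ c : M, a * c = b

/-- The order `a ≤_R b` of a monoid: `c * a = b` for some `c`. -/
def MLeR (a b : M) : Prop := ∃ c : M, c * a = b

/-- Any two elements have a greatest lower bound and a least upper bound for `r`. -/
def HasMeetsAndJoins (r : M → M → Prop) : Prop :=
  (∀ a b : M, ∃ d, r d a ∧ r d b ∧ ∀ c, r c a → r c b → r c d) ∧
  (∀ a b : M, ∃ d, r a d ∧ r b d ∧ ∀ c, r a c → r b c → r d c)

/-- Garside elements. -/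
structure IsGarsideElement (Δ : M) : Prop where
  balanced : ∀ a : M, MLeL a Δ ↔ MLeR a Δ
  generates : Submonoid.closure {a : M | MLeL a Δ} = ⊤

variable (M) in
/-- Atomic monoids. -/
structure IsAtomicMonoid : Prop where
  generates : Submonoid.closure {a : M | IsAtomElt a} = ⊤
  norm_lt_top : ∀ a : M, atomNorm a < ⊤

variable (M) in
/-- Garside monoids. (In an atomic monoid `1` is the only invertible element; with
cancellativity, `MLeL` and `MLeR` are therefore partial orders.) -/
structure IsGarsideMonoid : Prop where
  atomic : IsAtomicMonoid M
  fg : Monoid.FG M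
  left_cancel : ∀ a b c : M, a * b = a * c → b = c
  right_cancel : ∀ a b c : M, b * a = c * a → b = c
  lattice_L : HasMeetsAndJoins (MLeL : M → M → Prop)
  lattice_R : HasMeetsAndJoins (MLeR : M → M → Prop)
  exists_garside : ∃ Δ : M, IsGarsideElement Δ

end Monoids

section Groups

variable {G : Type*} [Group G]

/-- `G` is a Garside group with positive monoid `P = G⁺`: the submonoid `P` is a Garside monoid,
and `G` is its group of fractions. (A Garside monoid embeds in its group of fractions, and is
identified with its image `P` there.) -/
structure IsGarsideGroup (P : Submonoid G) : Prop where
  garside : IsGarsideMonoid P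
  fractions : ∀ g : G, ∃ a ∈ P, ∃ b ∈ P, g = a * b⁻¹

/-- The order `g ≤_L h` of a Garside group with positive monoid `P`: `g * c = h` for some
`c ∈ P`. -/
def LeL (P : Submonoid G) (g h : G) : Prop := ∃ c ∈ P, g * c = h

/-- `inf(g) = max {r ∈ ℤ : Δ ^ r ≤_L g}`. -/
noncomputable def inf (P : Submonoid G) (Δ g : G) : ℤ :=
  sSup {r : ℤ | LeL P (Δ ^ r) g}

/-- `sup(g) = min {s ∈ ℤ : g ≤_L Δ ^ s}`. -/
noncomputable def sup (P : Submonoid G) (Δ g : G) : ℤ :=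
  sInf {s : ℤ | LeL P g (Δ ^ s)}

/-- `len(g) = sup(g) - inf(g)`. -/
noncomputable def len (P : Submonoid G) (Δ g : G) : ℤ :=
  sup P Δ g - inf P Δ g

/-- `inf_s(g) = max {inf(h) : h conjugate to g}`. -/
noncomputable def infS (P : Submonoid G) (Δ g : G) : ℤ :=
  sSup {r : ℤ | ∃ h : G, IsConj g h ∧ inf P Δ h = r}

/-- `sup_s(g) = min {sup(h) : h conjugate to g}`. -/
noncomputable def supS (P : Submonoid G) (Δ g : G) : ℤ :=
  sInf {s : ℤ | ∃ h : G, IsConj g h ∧ sup P Δ h = s}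

/-- `len_s(g) = sup_s(g) - inf_s(g)`. -/
noncomputable def lenS (P : Submonoid G) (Δ g : G) : ℤ :=
  supS P Δ g - infS P Δ g

/-- `t_inf(g) = lim inf(g ^ n) / n`. -/
noncomputable def tInf (P : Submonoid G) (Δ g : G) : ℝ :=
  limUnder atTop (fun n : ℕ => (inf P Δ (g ^ n) : ℝ) / n)

/-- `t_sup(g) = lim sup(g ^ n) / n`. -/
noncomputable def tSup (P : Submonoid G) (Δ g : G) : ℝ :=
  limUnder atTop (fun n : ℕ => (sup P Δ (g ^ n) : ℝ) / n)

/-- `t_len(g) = lim len(g ^ n) / n`. -/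
noncomputable def tLen (P : Submonoid G) (Δ g : G) : ℝ :=
  limUnder atTop (fun n : ℕ => (len P Δ (g ^ n) : ℝ) / n)

/-- The maxima, minima and limits that define the invariants of `g` exist, and are the values
of the functions above. -/
structure InvariantsExist (P : Submonoid G) (Δ g : G) : Prop where
  inf_max : IsGreatest {r : ℤ | LeL P (Δ ^ r) g} (inf P Δ g)
  sup_min : IsLeast {s : ℤ | LeL P g (Δ ^ s)} (sup P Δ g)
  infS_max : IsGreatest {r : ℤ | ∃ h : G, IsConj g h ∧ inf P Δ h = r} (infS P Δ g)
  supS_min : IsLeast {s : ℤ | ∃ h : G, IsConj g h ∧ sup P Δ h = s} (supS P Δ g)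
  tInf_lim : Tendsto (fun n : ℕ => (inf P Δ (g ^ n) : ℝ) / n) atTop (𝓝 (tInf P Δ g))
  tSup_lim : Tendsto (fun n : ℕ => (sup P Δ (g ^ n) : ℝ) / n) atTop (𝓝 (tSup P Δ g))
  tLen_lim : Tendsto (fun n : ℕ => (len P Δ (g ^ n) : ℝ) / n) atTop (𝓝 (tLen P Δ g))

end Groups

end Garside

/-! Conjugation by `Δ` preserves `P`, so `sup(g) = -inf(g⁻¹)`, and likewise for the stable and
limiting versions. Hence (ii) is (i) for `g⁻¹`, and (iii) is the difference of the two. The limit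
exists by Fekete's lemma, since `inf` is superadditive. Conjugating changes `inf(gⁿ)` by a bounded
amount, which gives the lower bound in (i).

For the upper bound put `R = inf_s(g) + 1` and suppose `t_inf(g) > R - 1/N`. The elements `gᵃ Δ⁻ᵇ`
with `b ≤ a (R - 1/N)` are then bounded below by a power of `Δ`, so they have a greatest lower bound
`y` (`IsGarsideGroup.exists_inf`). Let `F x = g x Δ⁻ᴿ`; then `y Δ⁻¹ ≤_L Fᵏ y` for all `k ≤ N`. The
meets `y ∧ F y ∧ ⋯ ∧ Fⁿ y` descend strictly, since a repetition would give a conjugate of `g`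
divisible by `Δᴿ` (`exists_meet_iterates`). After `N` steps at least `N` atoms are lost, yet the
meet stays above `y Δ⁻¹`; as `‖Δ‖ = N`, it equals `y Δ⁻¹`. Iterating, the meet over `j ≤ N m` lies
below `y Δ⁻ᵐ`, which is too low for the assumed growth of `inf(gʲ)` (`exists_conj_zpow_leL`).

Optimality already occurs in `ℤ`, with `Δ = N` and `g = N - 1`. -/

namespace Garside

/-! ### The norm of an atomic monoid: attained and superadditive. -/

section Norm

variable {M : Type*} [Monoid M]

/-- The norm `‖a‖` as a natural number, for atomic monoids. -/
noncomputable def natNorm (a : M) : ℕ := (atomNorm a).toNat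

lemma length_le_atomNorm {a : M} {l : List M} (hl : ∀ x ∈ l, IsAtomElt x) (h : l.prod = a) :
    (l.length : ℕ∞) ≤ atomNorm a :=
  le_iSup₂ (f := fun (l : List M) (_ : (∀ x ∈ l, IsAtomElt x) ∧ l.prod = a) => (l.length : ℕ∞))
    l ⟨hl, h⟩

lemma IsAtomicMonoid.exists_list (hM : IsAtomicMonoid M) (a : M) :
    ∃ l : List M, (∀ x ∈ l, IsAtomElt x) ∧ l.prod = a :=
  Submonoid.exists_list_of_mem_closure (s := {a : M | IsAtomElt a}) (by simp [hM.generates])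

lemma IsAtomicMonoid.natNorm_coe (hM : IsAtomicMonoid M) (a : M) :
    (natNorm a : ℕ∞) = atomNorm a :=
  ENat.natCast_toNat (hM.norm_lt_top a).ne

lemma IsAtomicMonoid.length_le_natNorm (hM : IsAtomicMonoid M) {a : M} {l : List M}
    (hl : ∀ x ∈ l, IsAtomElt x) (h : l.prod = a) : l.length ≤ natNorm a := by
  have := length_le_atomNorm hl h
  rw [← hM.natNorm_coe] at this
  exact_mod_cast this

lemma IsAtomicMonoid.exists_length_eq (hM : IsAtomicMonoid M) (a : M) :
    ∃ l : List M, (∀ x ∈ l, IsAtomElt x) ∧ l.prod = a ∧ l.length = natNorm a := by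
  by_contra! hcon
  obtain ⟨l₀, h₀, h₀'⟩ := hM.exists_list a
  -- Positivity makes `natNorm a - 1` a genuine predecessor; it would bound all lengths if none
  -- attained the norm.
  have hpos : 0 < natNorm a := by
    have h1 := hM.length_le_natNorm h₀ h₀'
    have h2 := hcon l₀ h₀ h₀'
    omega
  have : atomNorm a ≤ ((natNorm a - 1 : ℕ) : ℕ∞) := by
    refine iSup₂_le fun l hl => ?_
    have h1 := hM.length_le_natNorm hl.1 hl.2
    have h2 := hcon l hl.1 hl.2
    exact_mod_cast (by omega : l.length ≤ natNorm a - 1)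
  rw [← hM.natNorm_coe] at this
  have : natNorm a ≤ natNorm a - 1 := by exact_mod_cast this
  omega

lemma IsAtomicMonoid.natNorm_add_le (hM : IsAtomicMonoid M) (a b : M) :
    natNorm a + natNorm b ≤ natNorm (a * b) := by
  obtain ⟨l, hl, hl', hl''⟩ := hM.exists_length_eq a
  obtain ⟨k, hk, hk', hk''⟩ := hM.exists_length_eq b
  rw [← hl'', ← hk'', ← List.length_append]
  refine hM.length_le_natNorm (fun x hx => ?_) (by simp [hl', hk'])
  rcases List.mem_append.1 hx with h | h
  exacts [hl x h, hk x h]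

lemma IsAtomicMonoid.natNorm_pos (hM : IsAtomicMonoid M) {a : M} (ha : a ≠ 1) :
    0 < natNorm a := by
  obtain ⟨l, hl, hl'⟩ := hM.exists_list a
  refine lt_of_lt_of_le (List.length_pos_iff.2 ?_) (hM.length_le_natNorm hl hl')
  rintro rfl
  exact ha (by simpa using hl'.symm)

lemma IsAtomicMonoid.natNorm_one (hM : IsAtomicMonoid M) : natNorm (1 : M) = 0 := by
  have := hM.natNorm_add_le (1 : M) 1
  rw [mul_one] at this
  omega

lemma IsAtomicMonoid.eq_one_of_mul_eq_one (hM : IsAtomicMonoid M) {a b : M} (h : a * b = 1) :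
    a = 1 := by
  by_contra ha
  have h1 := hM.natNorm_add_le a b
  have h2 := hM.natNorm_pos ha
  rw [h, hM.natNorm_one] at h1
  omega

end Norm

/-! ### Left divisibility in the group of fractions, and its meets. -/

section Order

variable {G : Type*} [Group G] {P : Submonoid G}

lemma leL_iff {g h : G} : LeL P g h ↔ g⁻¹ * h ∈ P :=
  ⟨by rintro ⟨c, hc, rfl⟩; simpa using hc, fun h => ⟨_, h, by group⟩⟩

lemma LeL.refl (g : G) : LeL P g g := leL_iff.2 (by simp)

lemma LeL.trans {a b c : G} (hab : LeL P a b) (hbc : LeL P b c) : LeL P a c := by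
  rw [leL_iff] at *
  have := P.mul_mem hab hbc
  rwa [show a⁻¹ * b * (b⁻¹ * c) = a⁻¹ * c by group] at this

lemma leL_mul_left_iff (x : G) {a b : G} : LeL P (x * a) (x * b) ↔ LeL P a b := by
  rw [leL_iff, leL_iff, show (x * a)⁻¹ * (x * b) = a⁻¹ * b by group]

/-- It suffices to treat the generators `y` dividing `Δ`. If `y c = Δ`, balancedness gives `c d =
Δ`, and then `Δ⁻¹ y Δ = d`; the other side is symmetric. -/
lemma IsGarsideElement.conj_mem {Δ : P} (hΔ : IsGarsideElement Δ) {x : G} (hx : x ∈ P) :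
    (Δ : G)⁻¹ * x * Δ ∈ P ∧ (Δ : G) * x * (Δ : G)⁻¹ ∈ P := by
  have hmem : (⟨x, hx⟩ : P) ∈ Submonoid.closure {a : P | MLeL a Δ} := by simp [hΔ.generates]
  suffices ∀ y : P, y ∈ Submonoid.closure {a : P | MLeL a Δ} →
      (Δ : G)⁻¹ * y * Δ ∈ P ∧ (Δ : G) * y * (Δ : G)⁻¹ ∈ P from this _ hmem
  intro y hy
  induction hy using Submonoid.closure_induction with
  | mem y hy =>
    constructor
    · obtain ⟨c, hc⟩ := hy
      obtain ⟨d, hd⟩ := (hΔ.balanced c).2 ⟨y, hc⟩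
      have : (Δ : G)⁻¹ * y * Δ = d := by
        nth_rw 2 [← hd]
        rw [← hc]; push_cast; group
      exact this ▸ d.2
    · obtain ⟨c, hc⟩ := (hΔ.balanced y).1 hy
      obtain ⟨d, hd⟩ := (hΔ.balanced c).1 ⟨y, hc⟩
      have : (Δ : G) * y * (Δ : G)⁻¹ = d := by
        nth_rw 1 [← hd]
        rw [← hc]; push_cast; group
      exact this ▸ d.2
  | one => simp
  | mul y z _ _ hy hz =>
    constructor
    · have := P.mul_mem hy.1 hz.1
      rwa [show (Δ : G)⁻¹ * y * Δ * ((Δ : G)⁻¹ * z * Δ) = (Δ : G)⁻¹ * ((y * z : P) : G) * Δ by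
        push_cast; group] at this
    · have := P.mul_mem hy.2 hz.2
      rwa [show (Δ : G) * y * (Δ : G)⁻¹ * ((Δ : G) * z * (Δ : G)⁻¹)
        = (Δ : G) * ((y * z : P) : G) * (Δ : G)⁻¹ by push_cast; group] at this

lemma IsGarsideElement.conj_zpow_mem {Δ : P} (hΔ : IsGarsideElement Δ) {x : G} (hx : x ∈ P)
    (k : ℤ) : (Δ : G) ^ k * x * (Δ : G) ^ (-k) ∈ P := by
  induction k using Int.induction_on with
  | zero => simpa using hx
  | succ n ih =>
    have := (hΔ.conj_mem ih).2
    convert this using 1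
    rw [zpow_neg, zpow_neg, zpow_add_one]
    group
  | pred n ih =>
    have := (hΔ.conj_mem ih).1
    convert this using 1
    rw [zpow_neg, zpow_neg, zpow_sub_one]
    group

lemma IsGarsideElement.leL_mul_zpow {Δ : P} (hΔ : IsGarsideElement Δ) {a b : G}
    (h : LeL P a b) (k : ℤ) : LeL P (a * (Δ : G) ^ k) (b * (Δ : G) ^ k) := by
  rw [leL_iff] at *
  have := hΔ.conj_zpow_mem h (-k)
  convert this using 1
  rw [neg_neg, mul_inv_rev, zpow_neg]
  group

lemma zpow_mem_of_nonneg (Δ : P) {k : ℤ} (hk : 0 ≤ k) : (Δ : G) ^ k ∈ P := by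
  lift k to ℕ using hk
  rw [zpow_natCast]
  exact P.pow_mem Δ.2 k

lemma leL_zpow_zpow (Δ : P) {k l : ℤ} (h : k ≤ l) : LeL P ((Δ : G) ^ k) ((Δ : G) ^ l) := by
  rw [leL_iff, ← zpow_neg, ← zpow_add]
  exact zpow_mem_of_nonneg Δ (by omega)

lemma IsGarsideElement.exists_pow_mul_inv_mem {Δ : P} (hΔ : IsGarsideElement Δ) (b : P) :
    ∃ n : ℕ, (Δ : G) ^ n * (b : G)⁻¹ ∈ P := by
  have hmem : b ∈ Submonoid.closure {a : P | MLeL a Δ} := by simp [hΔ.generates]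
  induction hmem using Submonoid.closure_induction with
  | mem y hy =>
    obtain ⟨c, hc⟩ := (hΔ.balanced y).1 hy
    refine ⟨1, ?_⟩
    rw [← hc]
    simp
  | one => exact ⟨0, by simp⟩
  | mul y z _ _ hy hz =>
    obtain ⟨m, hm⟩ := hy
    obtain ⟨n, hn⟩ := hz
    refine ⟨m + n, ?_⟩
    have h1 := P.mul_mem (hΔ.conj_zpow_mem hn m) hm
    convert h1 using 1
    push_cast
    rw [pow_add, zpow_neg, zpow_natCast]
    group

lemma IsGarsideGroup.exists_pow_mul_mem (hP : IsGarsideGroup P) {Δ : P}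
    (hΔ : IsGarsideElement Δ) (g : G) : ∃ n : ℕ, (Δ : G) ^ n * g ∈ P := by
  obtain ⟨a, ha, b, hb, rfl⟩ := hP.fractions g
  obtain ⟨n, hn⟩ := hΔ.exists_pow_mul_inv_mem ⟨b, hb⟩
  refine ⟨n, ?_⟩
  convert P.mul_mem (hΔ.conj_zpow_mem ha n) hn using 1
  rw [zpow_neg, zpow_natCast]
  group

lemma IsGarsideGroup.eq_one_of_mem_of_inv_mem (hP : IsGarsideGroup P) {x : G} (hx : x ∈ P)
    (hx' : x⁻¹ ∈ P) : x = 1 := by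
  have : (⟨x, hx⟩ : P) = 1 :=
    hP.garside.atomic.eq_one_of_mul_eq_one (b := ⟨x⁻¹, hx'⟩) (Subtype.ext (by simp))
  simpa using congrArg Subtype.val this

lemma IsGarsideGroup.zpow_mem_iff (hP : IsGarsideGroup P) {Δ : P} (hne : Δ ≠ 1) {k : ℤ} :
    (Δ : G) ^ k ∈ P ↔ 0 ≤ k := by
  refine ⟨fun h => ?_, zpow_mem_of_nonneg Δ⟩
  by_contra! hk
  have h1 := zpow_mem_of_nonneg Δ (show 0 ≤ -k - 1 by omega)
  have h2 : (Δ : G)⁻¹ ∈ P := by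
    convert P.mul_mem h1 h using 1
    rw [← zpow_add, ← zpow_neg_one]
    congr 1
    ring
  exact hne (Subtype.ext (by simpa using hP.eq_one_of_mem_of_inv_mem Δ.2 h2))

/-- Left translation preserves the order, and a large power of `Δ` moves any two elements into `P`,
where meets are given. -/
lemma IsGarsideGroup.exists_meet (hP : IsGarsideGroup P) (g h : G) :
    ∃ d, ∀ c, LeL P c d ↔ LeL P c g ∧ LeL P c h := by
  obtain ⟨Δ, hΔ⟩ := hP.garside.exists_garside
  have key : ∀ x y : G, x ∈ P → y ∈ P →
      ∃ d ∈ P, LeL P d x ∧ LeL P d y ∧ ∀ c ∈ P, LeL P c x → LeL P c y → LeL P c d := by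
    intro x y hx hy
    obtain ⟨d, ⟨u, hu⟩, ⟨v, hv⟩, hd⟩ := hP.garside.lattice_L.1 ⟨x, hx⟩ ⟨y, hy⟩
    refine ⟨d, d.2, ⟨u, u.2, congrArg Subtype.val hu⟩, ⟨v, v.2, congrArg Subtype.val hv⟩, ?_⟩
    rintro c hc ⟨s, hs, hs'⟩ ⟨t, ht, ht'⟩
    obtain ⟨w, hw⟩ := hd ⟨c, hc⟩ ⟨⟨s, hs⟩, Subtype.ext hs'⟩ ⟨⟨t, ht⟩, Subtype.ext ht'⟩
    exact ⟨w, w.2, congrArg Subtype.val hw⟩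
  have key2 : ∀ x y : G, x ∈ P → y ∈ P → ∃ d, ∀ c, LeL P c d ↔ LeL P c x ∧ LeL P c y := by
    intro x y hx hy
    obtain ⟨d, hd, hdx, hdy, hmax⟩ := key x y hx hy
    refine ⟨d, fun c => ⟨fun h => ⟨h.trans hdx, h.trans hdy⟩, fun ⟨hcx, hcy⟩ => ?_⟩⟩
    -- The lower bound `c` need not lie in `P`. The meet `e` taken after translation by `Δᵐ` is `Δᵐ
    -- e'` with `e' ∈ P`, whence `c ≤_L e' ≤_L d`.
    obtain ⟨m, hm⟩ := hP.exists_pow_mul_mem hΔ c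
    have hmP : (Δ : G) ^ m ∈ P := P.pow_mem Δ.2 m
    obtain ⟨e, he, hex, hey, hmax'⟩ := key _ _ (P.mul_mem hmP hx) (P.mul_mem hmP hy)
    have h1 : LeL P ((Δ : G) ^ m) e := hmax' _ hmP ⟨x, hx, rfl⟩ ⟨y, hy, rfl⟩
    have h2 := hmax' _ hm ((leL_mul_left_iff _).2 hcx) ((leL_mul_left_iff _).2 hcy)
    obtain ⟨e', he', rfl⟩ := h1
    rw [leL_mul_left_iff] at hex hey h2
    exact h2.trans (hmax e' he' hex hey)
  obtain ⟨m, hm⟩ := hP.exists_pow_mul_mem hΔ g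
  obtain ⟨n, hn⟩ := hP.exists_pow_mul_mem hΔ h
  obtain ⟨d, hd⟩ := key2 ((Δ : G) ^ (m + n) * g) ((Δ : G) ^ (m + n) * h)
    (by rw [add_comm, pow_add, mul_assoc]; exact P.mul_mem (P.pow_mem Δ.2 n) hm)
    (by rw [pow_add, mul_assoc]; exact P.mul_mem (P.pow_mem Δ.2 m) hn)
  refine ⟨((Δ : G) ^ (m + n))⁻¹ * d, fun c => ?_⟩
  rw [← leL_mul_left_iff ((Δ : G) ^ (m + n)), mul_inv_cancel_left, hd, leL_mul_left_iff,
    leL_mul_left_iff]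

/-- Nonempty subsets that are bounded below have a greatest lower bound. -/
lemma IsGarsideGroup.exists_inf (hP : IsGarsideGroup P) {S : Set G} (hS : S.Nonempty) {z : G}
    (hz : ∀ s ∈ S, LeL P z s) :
    ∃ y, LeL P z y ∧ ∀ c, LeL P c y ↔ ∀ s ∈ S, LeL P c s := by
  -- Among the `w` above `z` and above every lower bound of `S`, take one with `‖z⁻¹ w‖` minimal.
  -- Its meet with any `s ∈ S` is again such an element, so by minimality it is already below `s`.
  let T : Set ℕ := {n | ∃ (w : G) (hw : z⁻¹ * w ∈ P), natNorm (⟨z⁻¹ * w, hw⟩ : P) = n ∧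
    ∀ c, (∀ s ∈ S, LeL P c s) → LeL P c w}
  have hT : T.Nonempty := by
    obtain ⟨s, hs⟩ := hS
    exact ⟨_, s, leL_iff.1 (hz s hs), rfl, fun c hc => hc s hs⟩
  obtain ⟨y, hy, hyn, hyc⟩ := Nat.sInf_mem hT
  refine ⟨y, leL_iff.2 hy, fun c => ⟨fun h s hs => h.trans ?_, hyc c⟩⟩
  obtain ⟨w, hw⟩ := hP.exists_meet y s
  have hwy := ((hw w).1 (LeL.refl w)).1
  have hws := ((hw w).1 (LeL.refl w)).2
  have hzw := leL_iff.1 ((hw z).2 ⟨leL_iff.2 hy, hz s hs⟩)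
  have hmin : sInf T ≤ natNorm (⟨z⁻¹ * w, hzw⟩ : P) :=
    Nat.sInf_le ⟨w, hzw, rfl, fun c hc => (hw c).2 ⟨hyc c hc, hc s hs⟩⟩
  have hprod : (⟨z⁻¹ * w, hzw⟩ : P) * ⟨w⁻¹ * y, leL_iff.1 hwy⟩ = ⟨z⁻¹ * y, hy⟩ :=
    Subtype.ext (by simp [mul_assoc])
  have hadd := hP.garside.atomic.natNorm_add_le (⟨z⁻¹ * w, hzw⟩ : P) ⟨w⁻¹ * y, leL_iff.1 hwy⟩
  rw [hprod, hyn] at hadd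
  by_cases h1 : (⟨w⁻¹ * y, leL_iff.1 hwy⟩ : P) = 1
  · have : w = y := inv_mul_eq_one.1 (congrArg Subtype.val h1)
    exact this ▸ hws
  · have := hP.garside.atomic.natNorm_pos h1
    omega

end Order

end Garside

namespace Garside

/-! ### Existence of the invariants, inversion duality and the lower bound. -/

section Invariants

variable {G : Type*} [Group G] {P : Submonoid G} {Δ : P}

lemma leL_zpow_iff {r : ℤ} {g : G} : LeL P ((Δ : G) ^ r) g ↔ (Δ : G) ^ (-r) * g ∈ P := by
  rw [leL_iff, zpow_neg]

lemma IsGarsideElement.leL_zpow_iff_inv (hΔ : IsGarsideElement Δ) {s : ℤ} {g : G} :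
    LeL P g ((Δ : G) ^ s) ↔ LeL P ((Δ : G) ^ (-s)) g⁻¹ := by
  rw [leL_zpow_iff, neg_neg, leL_iff]
  constructor
  · intro h
    convert hΔ.conj_zpow_mem h s using 1
    rw [zpow_neg]
    group
  · intro h
    convert hΔ.conj_zpow_mem h (-s) using 1
    rw [neg_neg, zpow_neg]
    group

lemma IsGarsideElement.zpow_add_leL (hΔ : IsGarsideElement Δ) {r s : ℤ} {g h : G}
    (hg : LeL P ((Δ : G) ^ r) g) (hh : LeL P ((Δ : G) ^ s) h) :
    LeL P ((Δ : G) ^ (r + s)) (g * h) := by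
  have h1 := hΔ.leL_mul_zpow hg s
  rw [← zpow_add] at h1
  exact h1.trans ((leL_mul_left_iff g).2 hh)

lemma IsGarsideGroup.le_of_leL (hP : IsGarsideGroup P) (hne : Δ ≠ 1) {r s : ℤ} {g : G}
    (hr : LeL P ((Δ : G) ^ r) g) (hs : LeL P g ((Δ : G) ^ s)) : r ≤ s := by
  have := leL_iff.1 (hr.trans hs)
  rw [← zpow_neg, ← zpow_add, hP.zpow_mem_iff hne] at this
  omega

lemma IsGarsideGroup.exists_zpow_leL (hP : IsGarsideGroup P) (hΔ : IsGarsideElement Δ) (g : G) :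
    ∃ r : ℤ, LeL P ((Δ : G) ^ r) g := by
  obtain ⟨n, hn⟩ := hP.exists_pow_mul_mem hΔ g
  exact ⟨-n, leL_zpow_iff.2 (by simpa using hn)⟩

lemma IsGarsideGroup.exists_leL_zpow (hP : IsGarsideGroup P) (hΔ : IsGarsideElement Δ) (g : G) :
    ∃ s : ℤ, LeL P g ((Δ : G) ^ s) := by
  obtain ⟨r, hr⟩ := hP.exists_zpow_leL hΔ g⁻¹
  exact ⟨-r, hΔ.leL_zpow_iff_inv.2 (by simpa using hr)⟩

lemma isGreatest_csSup_int {S : Set ℤ} (h : S.Nonempty) (hb : BddAbove S) :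
    IsGreatest S (sSup S) :=
  ⟨Int.csSup_mem h hb, fun _ hx => le_csSup hb hx⟩

lemma isGreatest_inf (hP : IsGarsideGroup P) (hΔ : IsGarsideElement Δ) (hne : Δ ≠ 1) (g : G) :
    IsGreatest {r : ℤ | LeL P ((Δ : G) ^ r) g} (inf P Δ g) := by
  obtain ⟨s, hs⟩ := hP.exists_leL_zpow hΔ g
  exact isGreatest_csSup_int (hP.exists_zpow_leL hΔ g) ⟨s, fun r hr => hP.le_of_leL hne hr hs⟩

lemma le_inf_iff (hP : IsGarsideGroup P) (hΔ : IsGarsideElement Δ) (hne : Δ ≠ 1) {g : G} {r : ℤ} :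
    r ≤ inf P Δ g ↔ LeL P ((Δ : G) ^ r) g :=
  ⟨fun h => (leL_zpow_zpow Δ h).trans (isGreatest_inf hP hΔ hne g).1,
    fun h => (isGreatest_inf hP hΔ hne g).2 h⟩

lemma isLeast_neg_inf_inv (hP : IsGarsideGroup P) (hΔ : IsGarsideElement Δ) (hne : Δ ≠ 1) (g : G) :
    IsLeast {s : ℤ | LeL P g ((Δ : G) ^ s)} (-inf P Δ g⁻¹) := by
  obtain ⟨h1, h2⟩ := isGreatest_inf hP hΔ hne g⁻¹
  refine ⟨hΔ.leL_zpow_iff_inv.2 (by simpa using h1), fun s hs => ?_⟩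
  have := h2 (hΔ.leL_zpow_iff_inv.1 hs)
  omega

lemma sup_eq (hP : IsGarsideGroup P) (hΔ : IsGarsideElement Δ) (hne : Δ ≠ 1) (g : G) :
    sup P Δ g = -inf P Δ g⁻¹ :=
  (isLeast_neg_inf_inv hP hΔ hne g).csInf_eq

lemma inf_le_sup (hP : IsGarsideGroup P) (hΔ : IsGarsideElement Δ) (hne : Δ ≠ 1) (g : G) :
    inf P Δ g ≤ sup P Δ g :=
  hP.le_of_leL hne (isGreatest_inf hP hΔ hne g).1
    (sup_eq hP hΔ hne g ▸ (isLeast_neg_inf_inv hP hΔ hne g).1)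

lemma inf_add_inf_le (hP : IsGarsideGroup P) (hΔ : IsGarsideElement Δ) (hne : Δ ≠ 1) (g h : G) :
    inf P Δ g + inf P Δ h ≤ inf P Δ (g * h) :=
  (le_inf_iff hP hΔ hne).2
    (hΔ.zpow_add_leL (isGreatest_inf hP hΔ hne g).1 (isGreatest_inf hP hΔ hne h).1)

lemma inf_one (hP : IsGarsideGroup P) (hne : Δ ≠ 1) :
    inf P Δ (1 : G) = 0 := by
  refine (IsGreatest.csSup_eq (a := (0 : ℤ)) ⟨?_, fun r hr => ?_⟩)
  · exact (show LeL P ((Δ : G) ^ (0 : ℤ)) 1 by rw [zpow_zero]; exact LeL.refl 1)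
  · exact hP.le_of_leL hne hr (by rw [zpow_zero]; exact LeL.refl 1)

lemma mul_inf_le (hP : IsGarsideGroup P) (hΔ : IsGarsideElement Δ) (hne : Δ ≠ 1) (g : G) (n : ℕ) :
    n * inf P Δ g ≤ inf P Δ (g ^ n) := by
  induction n with
  | zero => simp [inf_one hP hne]
  | succ n ih =>
    have := inf_add_inf_le hP hΔ hne (g ^ n) g
    rw [pow_succ]
    push_cast
    linarith

lemma inf_pow_le (hP : IsGarsideGroup P) (hΔ : IsGarsideElement Δ) (hne : Δ ≠ 1) (g : G) (n : ℕ) :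
    inf P Δ (g ^ n) ≤ n * sup P Δ g := by
  have h1 := inf_le_sup hP hΔ hne (g ^ n)
  rw [sup_eq hP hΔ hne] at h1 ⊢
  have h2 := mul_inf_le hP hΔ hne g⁻¹ n
  rw [inv_pow] at h2
  linarith

/-- Fekete's lemma for the subadditive sequence `-inf(gⁿ)`, with `inf(gⁿ) ≤ n sup(g)` supplying the
bound. -/
lemma tendsto_tInf (hP : IsGarsideGroup P) (hΔ : IsGarsideElement Δ) (hne : Δ ≠ 1) (g : G) :
    Tendsto (fun n : ℕ => (inf P Δ (g ^ n) : ℝ) / n) atTop (𝓝 (tInf P Δ g)) := by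
  have hsub : Subadditive fun n : ℕ => -(inf P Δ (g ^ n) : ℝ) := by
    intro m n
    have := inf_add_inf_le hP hΔ hne (g ^ m) (g ^ n)
    rw [← pow_add] at this
    have : (inf P Δ (g ^ m) : ℝ) + inf P Δ (g ^ n) ≤ inf P Δ (g ^ (m + n)) := by exact_mod_cast this
    dsimp only
    linarith
  have hbdd : BddBelow (Set.range fun n : ℕ => -(inf P Δ (g ^ n) : ℝ) / n) := by
    -- The `0` covers the index `n = 0`, where the quotient is `0` by convention.
    refine ⟨min 0 (-(sup P Δ g : ℝ)), ?_⟩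
    rintro _ ⟨n, rfl⟩
    rcases Nat.eq_zero_or_pos n with rfl | hn
    · simp
    · refine (min_le_right _ _).trans ?_
      have h1 : (inf P Δ (g ^ n) : ℝ) ≤ n * sup P Δ g := by exact_mod_cast inf_pow_le hP hΔ hne g n
      rw [le_div_iff₀ (by exact_mod_cast hn)]
      linarith
  have h := (hsub.tendsto_lim hbdd).neg
  refine tendsto_nhds_limUnder ⟨_, h.congr fun n => ?_⟩
  rw [neg_div, neg_neg]

/-- Conjugate elements have powers whose infima differ by a bounded amount. -/
lemma exists_inf_conj_pow (hP : IsGarsideGroup P) (hΔ : IsGarsideElement Δ) (hne : Δ ≠ 1)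
    {g h : G} (hgh : IsConj g h) :
    ∃ C : ℤ, ∀ n : ℕ, n * inf P Δ h - C ≤ inf P Δ (g ^ n) := by
  obtain ⟨x, hx⟩ := isConj_iff.1 hgh
  refine ⟨-(inf P Δ x⁻¹ + inf P Δ x), fun n => ?_⟩
  have hpow : g ^ n = x⁻¹ * h ^ n * x := by
    rw [← hx, conj_pow]
    group
  have h1 := inf_add_inf_le hP hΔ hne (x⁻¹ * h ^ n) x
  have h2 := inf_add_inf_le hP hΔ hne x⁻¹ (h ^ n)
  have h3 := mul_inf_le hP hΔ hne h n
  rw [hpow]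
  linarith

lemma inf_le_tInf_of_isConj (hP : IsGarsideGroup P) (hΔ : IsGarsideElement Δ) (hne : Δ ≠ 1)
    {g h : G} (hgh : IsConj g h) : (inf P Δ h : ℝ) ≤ tInf P Δ g := by
  obtain ⟨C, hC⟩ := exists_inf_conj_pow hP hΔ hne hgh
  have hlim : Tendsto (fun n : ℕ => (inf P Δ h : ℝ) - C / n) atTop (𝓝 ((inf P Δ h : ℝ) - 0)) :=
    tendsto_const_nhds.sub (tendsto_const_div_atTop_nhds_zero_nat (C : ℝ))
  rw [sub_zero] at hlim
  refine le_of_tendsto_of_tendsto hlim (tendsto_tInf hP hΔ hne g) ?_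
  filter_upwards [eventually_gt_atTop 0] with n hn
  have hn' : (0 : ℝ) < n := by exact_mod_cast hn
  have h1 : (n : ℝ) * inf P Δ h - C ≤ inf P Δ (g ^ n) := by exact_mod_cast hC n
  rw [le_div_iff₀ hn', sub_mul, div_mul_cancel₀ _ hn'.ne']
  linarith

/-- The limit `t_inf(g)` bounds `inf` on the whole conjugacy class, so the integer maximum is
attained. -/
lemma isGreatest_infS (hP : IsGarsideGroup P) (hΔ : IsGarsideElement Δ) (hne : Δ ≠ 1) (g : G) :
    IsGreatest {r : ℤ | ∃ h : G, IsConj g h ∧ inf P Δ h = r} (infS P Δ g) := by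
  refine isGreatest_csSup_int ⟨_, g, IsConj.refl g, rfl⟩ ⟨⌈tInf P (Δ : G) g⌉, ?_⟩
  rintro _ ⟨h, hgh, rfl⟩
  exact_mod_cast (inf_le_tInf_of_isConj hP hΔ hne hgh).trans (Int.le_ceil _)

lemma infS_le_tInf (hP : IsGarsideGroup P) (hΔ : IsGarsideElement Δ) (hne : Δ ≠ 1) (g : G) :
    (infS P Δ g : ℝ) ≤ tInf P Δ g := by
  obtain ⟨h, hgh, hh⟩ := (isGreatest_infS hP hΔ hne g).1
  rw [← hh]
  exact inf_le_tInf_of_isConj hP hΔ hne hgh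

lemma isConj_inv {g h : G} (H : IsConj g h) : IsConj g⁻¹ h⁻¹ := by
  obtain ⟨x, hx⟩ := isConj_iff.1 H
  exact isConj_iff.2 ⟨x, by rw [← hx]; group⟩

lemma isLeast_neg_infS_inv (hP : IsGarsideGroup P) (hΔ : IsGarsideElement Δ) (hne : Δ ≠ 1)
    (g : G) :
    IsLeast {s : ℤ | ∃ h : G, IsConj g h ∧ sup P Δ h = s} (-infS P Δ g⁻¹) := by
  obtain ⟨⟨h, hgh, hh⟩, hmax⟩ := isGreatest_infS hP hΔ hne g⁻¹
  constructor
  · exact ⟨h⁻¹, by simpa using isConj_inv hgh, by rw [sup_eq hP hΔ hne, inv_inv, hh]⟩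
  · rintro _ ⟨k, hgk, rfl⟩
    have := hmax ⟨k⁻¹, isConj_inv hgk, rfl⟩
    rw [sup_eq hP hΔ hne]
    omega

lemma supS_eq (hP : IsGarsideGroup P) (hΔ : IsGarsideElement Δ) (hne : Δ ≠ 1) (g : G) :
    supS P Δ g = -infS P Δ g⁻¹ :=
  (isLeast_neg_infS_inv hP hΔ hne g).csInf_eq

lemma tendsto_sup (hP : IsGarsideGroup P) (hΔ : IsGarsideElement Δ) (hne : Δ ≠ 1) (g : G) :
    Tendsto (fun n : ℕ => (sup P Δ (g ^ n) : ℝ) / n) atTop (𝓝 (-tInf P Δ g⁻¹)) := by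
  refine (tendsto_tInf hP hΔ hne g⁻¹).neg.congr fun n => ?_
  rw [sup_eq hP hΔ hne, inv_pow]
  push_cast
  ring

lemma tSup_eq (hP : IsGarsideGroup P) (hΔ : IsGarsideElement Δ) (hne : Δ ≠ 1) (g : G) :
    tSup P Δ g = -tInf P Δ g⁻¹ :=
  (tendsto_sup hP hΔ hne g).limUnder_eq

lemma tendsto_len (hP : IsGarsideGroup P) (hΔ : IsGarsideElement Δ) (hne : Δ ≠ 1) (g : G) :
    Tendsto (fun n : ℕ => (len P Δ (g ^ n) : ℝ) / n) atTop
      (𝓝 (-tInf P Δ g⁻¹ - tInf P Δ g)) := by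
  refine ((tendsto_sup hP hΔ hne g).sub (tendsto_tInf hP hΔ hne g)).congr fun n => ?_
  rw [len]
  push_cast
  ring

lemma tLen_eq (hP : IsGarsideGroup P) (hΔ : IsGarsideElement Δ) (hne : Δ ≠ 1) (g : G) :
    tLen P Δ g = -tInf P Δ g⁻¹ - tInf P Δ g :=
  (tendsto_len hP hΔ hne g).limUnder_eq

lemma invariantsExist (hP : IsGarsideGroup P) (hΔ : IsGarsideElement Δ) (hne : Δ ≠ 1) (g : G) :
    InvariantsExist P (Δ : G) g where
  inf_max := isGreatest_inf hP hΔ hne g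
  sup_min := sup_eq hP hΔ hne g ▸ isLeast_neg_inf_inv hP hΔ hne g
  infS_max := isGreatest_infS hP hΔ hne g
  supS_min := supS_eq hP hΔ hne g ▸ isLeast_neg_infS_inv hP hΔ hne g
  tInf_lim := tendsto_tInf hP hΔ hne g
  tSup_lim := tSup_eq hP hΔ hne g ▸ tendsto_sup hP hΔ hne g
  tLen_lim := tLen_eq hP hΔ hne g ▸ tendsto_len hP hΔ hne g

end Invariants

end Garside

namespace Garside

/-! ### The upper bound for `t_inf`. -/

section UpperBound

variable {G : Type*} [Group G] {P : Submonoid G} {Δ : P}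

lemma leL_twist_iff (hΔ : IsGarsideElement Δ) (w : G) (k : ℤ) {a b : G} :
    LeL P (w * a * (Δ : G) ^ k) (w * b * (Δ : G) ^ k) ↔ LeL P a b := by
  refine ⟨fun h => ?_, fun h => hΔ.leL_mul_zpow ((leL_mul_left_iff w).2 h) k⟩
  have := hΔ.leL_mul_zpow h (-k)
  simpa [mul_assoc, ← zpow_add, leL_mul_left_iff] using this

/-- The meets `y ∧ F y ∧ ⋯ ∧ Fⁿ y` of the iterates of `F x = g x Δ⁻ᴿ`; if the sequence of these
meets is stationary, a conjugate of `g` is divisible by `Δᴿ`. -/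
lemma exists_meet_iterates (hP : IsGarsideGroup P) (hΔ : IsGarsideElement Δ) (g y : G) (R : ℤ)
    (hcon : ∀ x : G, ¬ LeL P ((Δ : G) ^ R) (x⁻¹ * g * x)) :
    ∃ x : ℕ → G, x 0 = y ∧ (∀ n, LeL P (x (n + 1)) (x n) ∧ x (n + 1) ≠ x n) ∧
      ∀ n c, LeL P c (x n) ↔ ∀ j ≤ n, LeL P c (g ^ j * y * (Δ : G) ^ (-(j * R))) := by
  choose m hm using hP.exists_meet
  -- The recursion `xₙ₊₁ = y ∧ F xₙ` is used because `xₙ₊₁ = xₙ` then gives `xₙ ≤_L F xₙ` at once,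
  -- that is, `Δᴿ ≤_L xₙ⁻¹ g xₙ`.
  let x : ℕ → G := fun n => Nat.rec y (fun _ z => m y (g * z * (Δ : G) ^ (-R))) n
  have hx : ∀ n, x (n + 1) = m y (g * x n * (Δ : G) ^ (-R)) := fun n => rfl
  have hchar : ∀ n c, LeL P c (x n) ↔
      ∀ j ≤ n, LeL P c (g ^ j * y * (Δ : G) ^ (-((j : ℤ) * R))) := by
    intro n
    induction n with
    | zero =>
      intro c
      simp [x]
    | succ n ih =>
      intro c
      have hc : c = g * (g⁻¹ * c * (Δ : G) ^ R) * (Δ : G) ^ (-R) := by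
        rw [zpow_neg]; group
      have hstep : ∀ j : ℕ, LeL P (g⁻¹ * c * (Δ : G) ^ R)
          (g ^ j * y * (Δ : G) ^ (-((j : ℤ) * R))) ↔
          LeL P c (g ^ (j + 1) * y * (Δ : G) ^ (-(((j + 1 : ℕ) : ℤ) * R))) := by
        intro j
        rw [← leL_twist_iff hΔ g (-R), ← hc]
        have : g * (g ^ j * y * (Δ : G) ^ (-((j : ℤ) * R))) * (Δ : G) ^ (-R)
            = g ^ (j + 1) * y * (Δ : G) ^ (-(((j + 1 : ℕ) : ℤ) * R)) := by
          have : (-(((j + 1 : ℕ) : ℤ) * R)) = -((j : ℤ) * R) + -R := by push_cast; ring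
          rw [this, zpow_add, pow_succ']
          simp only [mul_assoc]
        rw [this]
      rw [hx, hm]
      nth_rw 2 [hc]
      rw [leL_twist_iff hΔ, ih]
      constructor
      · rintro ⟨h0, h1⟩ (_ | j) hj
        · simpa using h0
        · exact (hstep j).1 (h1 j (by omega))
      · intro h
        exact ⟨by simpa using h 0 (by omega), fun j hj => (hstep j).2 (h (j + 1) (by omega))⟩
  refine ⟨x, rfl, fun n => ⟨?_, fun heq => ?_⟩, hchar⟩
  · exact (hchar n _).2 fun j hj => (hchar (n + 1) _).1 (LeL.refl _) j (by omega)
  · have h := ((hm _ _ _).1 (hx n ▸ LeL.refl (x (n + 1)))).2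
    rw [← hx, heq] at h
    have h' := hΔ.leL_mul_zpow h R
    refine hcon (x n) ?_
    rw [← leL_mul_left_iff (x n)]
    convert h' using 1
    rw [zpow_neg]
    group

/-- If the infima of the powers of `g` grow faster than `(R - 1 / N) n`, then some conjugate of
`g` is divisible by `Δᴿ`. -/
lemma exists_conj_zpow_leL (hP : IsGarsideGroup P) (hΔ : IsGarsideElement Δ) (hne : Δ ≠ 1)
    {N : ℕ} (hN : natNorm Δ = N) (g : G) (R : ℤ)
    (hbdd : ∃ C : ℤ, ∀ (a : ℕ) (b : ℤ), N * b ≤ a * (N * R - 1) →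
      LeL P ((Δ : G) ^ (-C)) (g ^ a * (Δ : G) ^ (-b)))
    (hgrowth : ∀ C : ℤ, ∃ m : ℕ, ∀ j ≤ N * m, j * R - m + C ≤ inf P Δ (g ^ j)) :
    ∃ x : G, LeL P ((Δ : G) ^ R) (x⁻¹ * g * x) := by
  by_contra! hcon
  obtain ⟨C, hC⟩ := hbdd
  let S : Set G := {s | ∃ (a : ℕ) (b : ℤ), (N : ℤ) * b ≤ a * (N * R - 1) ∧
    s = g ^ a * (Δ : G) ^ (-b)}
  obtain ⟨y, hCy, hy⟩ := hP.exists_inf (S := S) (z := (Δ : G) ^ (-C))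
    ⟨1, 0, 0, by simp, by simp⟩ (by rintro _ ⟨a, b, hab, rfl⟩; exact hC a b hab)
  have hstab : ∀ k : ℕ, k ≤ N →
      LeL P (y * (Δ : G) ^ (-1 : ℤ)) (g ^ k * y * (Δ : G) ^ (-((k : ℤ) * R))) := by
    intro k hk
    have h1 : LeL P ((g ^ k)⁻¹ * y * (Δ : G) ^ ((k : ℤ) * R - 1)) y := by
      rw [hy]
      rintro _ ⟨a, b, hab, rfl⟩
      have hk' : (k : ℤ) ≤ N := by exact_mod_cast hk
      have h2 : LeL P y (g ^ (k + a) * (Δ : G) ^ (-(b + (k * R - 1)))) := by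
        -- The new pair is admissible because `N (b + k R - 1) ≤ (k + a)(N R - 1)` loses `N` on the
        -- left and only `k ≤ N` on the right.
        refine (hy y).1 (LeL.refl y) _ ⟨k + a, _, ?_, rfl⟩
        push_cast
        linarith
      rw [← leL_twist_iff hΔ (g ^ k)⁻¹ ((k : ℤ) * R - 1)] at h2
      convert h2 using 1
      rw [pow_add]
      simp only [mul_assoc, ← zpow_add, inv_mul_cancel_left]
      congr 2
      ring
    rw [← leL_twist_iff hΔ (g ^ k) (-((k : ℤ) * R))] at h1
    convert h1 using 1
    simp only [mul_assoc, ← zpow_add, mul_inv_cancel_left]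
    congr 2
    ring
  obtain ⟨x, hx0, hxlt, hx⟩ := exists_meet_iterates hP hΔ g y R hcon
  -- Each strict descent adds at least one to the norm of `xₙ⁻¹ y`.
  have hdiv : ∀ n, ∃ s : P, x n * s = y ∧ n ≤ natNorm s := by
    intro n
    induction n with
    | zero => exact ⟨1, by simp [hx0], Nat.zero_le _⟩
    | succ n ih =>
      obtain ⟨s, hs, hns⟩ := ih
      obtain ⟨⟨u, hu, hxu⟩, hneq⟩ := hxlt n
      refine ⟨⟨u, hu⟩ * s, by rw [← hs, ← hxu]; simp [mul_assoc], ?_⟩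
      have h1 := hP.garside.atomic.natNorm_add_le (⟨u, hu⟩ : P) s
      have h2 := hP.garside.atomic.natNorm_pos (a := (⟨u, hu⟩ : P)) (by
        intro h
        have : u = 1 := congrArg Subtype.val h
        exact hneq (by rw [← hxu, this, mul_one]))
      omega
  -- Here `Δ = d s` with `‖s‖ ≥ N = ‖Δ‖`, which leaves no room for `d ≠ 1`.
  have hxN : x N = y * (Δ : G) ^ (-1 : ℤ) := by
    obtain ⟨d, hd, hd'⟩ := (hx N _).2 hstab
    obtain ⟨s, hs, hns⟩ := hdiv N
    have hds : (⟨d, hd⟩ : P) * s = Δ := by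
      refine Subtype.ext ?_
      rw [← hd', mul_assoc, mul_assoc] at hs
      have := mul_eq_left.1 hs
      rw [zpow_neg_one, inv_mul_eq_one] at this
      simpa using this.symm
    have h1 := hP.garside.atomic.natNorm_add_le (⟨d, hd⟩ : P) s
    rw [hds, hN] at h1
    have h2 : (⟨d, hd⟩ : P) = 1 := by
      by_contra h
      have := hP.garside.atomic.natNorm_pos h
      omega
    have : d = 1 := congrArg Subtype.val h2
    rw [← hd', this, mul_one]
  have hmeet : ∀ (m : ℕ) (c : G),
      (∀ j ≤ N * m, LeL P c (g ^ j * y * (Δ : G) ^ (-((j : ℤ) * R)))) →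
      LeL P c (y * (Δ : G) ^ (-(m : ℤ))) := by
    intro m
    induction m with
    | zero =>
      intro c h
      simpa using h 0 (by simp)
    | succ m ih =>
      intro c h
      -- For each `i ≤ N m`, the window `i, …, i + N` gives `c ≤_L Fⁱ (x N) = (Fⁱ y) Δ⁻¹`; so `c Δ`
      -- satisfies the hypothesis for `m`.
      have h1 := ih (c * (Δ : G) ^ (1 : ℤ)) fun i hi => ?_
      · have h2 := hΔ.leL_mul_zpow h1 (-1)
        convert h2 using 1
        · simp [mul_assoc]
        · rw [mul_assoc, ← zpow_add]
          push_cast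
          congr 2
          ring
      · have h1 : LeL P ((g ^ i)⁻¹ * c * (Δ : G) ^ ((i : ℤ) * R)) (x N) := by
          rw [hx]
          intro j hj
          have h2 := h (i + j) (by rw [mul_add, mul_one]; omega)
          rw [← leL_twist_iff hΔ (g ^ i)⁻¹ ((i : ℤ) * R)] at h2
          convert h2 using 1
          rw [pow_add]
          simp only [mul_assoc, ← zpow_add, inv_mul_cancel_left]
          congr 3
          push_cast
          ring
        rw [hxN, ← leL_twist_iff hΔ (g ^ i) (-((i : ℤ) * R) + 1)] at h1
        convert h1 using 1
        · simp only [mul_assoc, ← zpow_add, mul_inv_cancel_left]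
          congr 2
          ring
        · simp only [mul_assoc, ← zpow_add]
          congr 3
          ring
  obtain ⟨C', hyC'⟩ := hP.exists_leL_zpow hΔ y
  obtain ⟨m, hmg⟩ := hgrowth (C + C' + 1)
  -- The chain `y Δ¹⁻ᵐ ≤_L Δ^(C' + 1 - m) ≤_L gʲ Δ^(-C - j R) ≤_L Fʲ y` explains the constant `C +
  -- C' + 1`. The conclusion `y Δ¹⁻ᵐ ≤_L y Δ⁻ᵐ` is absurd.
  have h1 := hmeet m (y * (Δ : G) ^ (1 - m : ℤ)) fun j hj => by
    have h2 : LeL P ((Δ : G) ^ (C' + (1 - m : ℤ)))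
        (g ^ j * (Δ : G) ^ (-C) * (Δ : G) ^ (-((j : ℤ) * R))) := by
      have h3 := hΔ.leL_mul_zpow ((le_inf_iff hP hΔ hne).1 (hmg j hj)) (-C + -((j : ℤ) * R))
      rw [← zpow_add, zpow_add _ (-C), ← mul_assoc] at h3
      convert h3 using 2
      ring
    have h3 := hΔ.leL_mul_zpow hyC' (1 - m : ℤ)
    rw [← zpow_add] at h3
    exact h3.trans (h2.trans ((leL_twist_iff hΔ _ _).2 hCy))
  rw [leL_mul_left_iff] at h1
  have := hP.le_of_leL hne (LeL.refl _) h1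
  omega

lemma tInf_le_infS (hP : IsGarsideGroup P) (hΔ : IsGarsideElement Δ) (hne : Δ ≠ 1)
    {N : ℕ} (hN : natNorm Δ = N) (g : G) :
    tInf P (Δ : G) g ≤ (infS P (Δ : G) g : ℝ) + 1 - 1 / (N : ℝ) := by
  by_contra! hlt
  set R : ℤ := infS P (Δ : G) g + 1 with hR
  have hN0 : 0 < N := hN ▸ hP.garside.atomic.natNorm_pos hne
  have hN' : (0 : ℝ) < N := by exact_mod_cast hN0
  -- A slope `t < t_inf(g)` gives `inf(gᵃ) ≥ a t - C` for all `a`; `t < R` makes `j (R - t)`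
  -- increase with `j`.
  obtain ⟨t, ht1, ht2⟩ : ∃ t : ℝ, (R : ℝ) - 1 / N < t ∧ t < min (tInf P (Δ : G) g) R := by
    refine exists_between (lt_min ?_ ?_)
    · rw [hR]; push_cast; exact hlt
    · have : (0 : ℝ) < 1 / N := by positivity
      linarith
  obtain ⟨C, hC⟩ : ∃ C : ℤ, ∀ a : ℕ, a * t - C ≤ (inf P (Δ : G) (g ^ a) : ℝ) := by
    obtain ⟨n₀, hn₀⟩ := eventually_atTop.1 ((tendsto_tInf hP hΔ hne g).eventually
      (lt_mem_nhds (lt_of_lt_of_le ht2 (min_le_left _ _))))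
    obtain ⟨B, hB⟩ := ((Finset.range (n₀ + 1)).image
      fun a : ℕ => a * t - (inf P (Δ : G) (g ^ a) : ℝ)).bddAbove
    refine ⟨max ⌈B⌉ 0, fun a => ?_⟩
    push_cast
    rcases le_or_gt a n₀ with ha | ha
    · have h1 : a * t - (inf P (Δ : G) (g ^ a) : ℝ) ≤ B :=
        hB (by simpa using ⟨a, by omega, rfl⟩)
      have h2 := Int.le_ceil B
      have h3 := le_max_left (⌈B⌉ : ℝ) 0
      linarith
    · have ha' : (0 : ℝ) < a := by exact_mod_cast (by omega : 0 < a)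
      have h1 := (lt_div_iff₀ ha').1 (hn₀ a ha.le)
      have h2 := le_max_right (⌈B⌉ : ℝ) 0
      linarith
  have hbdd : ∃ C : ℤ, ∀ (a : ℕ) (b : ℤ), N * b ≤ a * (N * R - 1) →
      LeL P ((Δ : G) ^ (-C)) (g ^ a * (Δ : G) ^ (-b)) := by
    refine ⟨C, fun a b hab => ?_⟩
    have h1 : b - C ≤ inf P (Δ : G) (g ^ a) := by
      have h2 : (N : ℝ) * b ≤ a * (N * R - 1) := by exact_mod_cast hab
      have h3 : (b : ℝ) ≤ a * (R - 1 / N) := by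
        rw [← mul_le_mul_iff_right₀ hN']
        calc (N : ℝ) * b ≤ a * (N * R - 1) := h2
          _ = N * (a * (R - 1 / N)) := by field_simp
      have h4 : (a : ℝ) * (R - 1 / N) ≤ a * t :=
        mul_le_mul_of_nonneg_left ht1.le (Nat.cast_nonneg a)
      have h5 := hC a
      have : ((b - C : ℤ) : ℝ) ≤ inf P (Δ : G) (g ^ a) := by push_cast; linarith
      exact_mod_cast this
    have h2 := hΔ.leL_mul_zpow ((le_inf_iff hP hΔ hne).1 h1) (-b)
    rw [← zpow_add] at h2
    convert h2 using 2
    ring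
  have hgrowth : ∀ C : ℤ, ∃ m : ℕ, ∀ j ≤ N * m, j * R - m + C ≤ inf P (Δ : G) (g ^ j) := by
    intro C'
    -- With `δ = N (t - (R - 1/N))`, every `j ≤ N m` has `j (R - t) ≤ m - m δ`; `m` is chosen so
    -- that `m δ ≥ C + C'`.
    have hδ : 0 < N * (t - (R - 1 / N)) := mul_pos hN' (by linarith)
    obtain ⟨m, hm⟩ := exists_nat_ge ((C + C' : ℝ) / (N * (t - (R - 1 / N))))
    rw [div_le_iff₀ hδ] at hm
    refine ⟨m, fun j hj => ?_⟩
    have hj' : (j : ℝ) ≤ N * m := by exact_mod_cast hj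
    have h1 : (j : ℝ) * (R - t) ≤ N * m * (R - t) :=
      mul_le_mul_of_nonneg_right hj' (by linarith [min_le_right (tInf P (Δ : G) g) (R : ℝ)])
    have h2 : (N : ℝ) * m * (R - t) = m - m * (N * (t - (R - 1 / N))) := by field_simp; ring
    have h3 := hC j
    have : ((j * R - m + C' : ℤ) : ℝ) ≤ inf P (Δ : G) (g ^ j) := by push_cast; linarith
    exact_mod_cast this
  obtain ⟨x, hx⟩ := exists_conj_zpow_leL hP hΔ hne hN g R hbdd hgrowth
  have h1 := (le_inf_iff hP hΔ hne).2 hx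
  have h2 := (isGreatest_infS hP hΔ hne g).2
    ⟨x⁻¹ * g * x, isConj_iff.2 ⟨x⁻¹, by group⟩, rfl⟩
  omega

end UpperBound

end Garside

namespace Garside

/-! ### The Garside group `ℤ` with `Δ = N`, for optimality. -/

section Integers

/-- The natural numbers, as the positive monoid of the Garside group `ℤ`. -/
def natSubmonoid : Submonoid (Multiplicative ℤ) where
  carrier := {x | 0 ≤ x.toAdd}
  one_mem' := le_refl (0 : ℤ)
  mul_mem' := fun {_ _} ha hb => add_nonneg (α := ℤ) ha hb

/-- The natural number `n` as an element of `natSubmonoid`. -/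
def ofNatural (n : ℕ) : natSubmonoid := ⟨Multiplicative.ofAdd (n : ℤ), Int.natCast_nonneg n⟩

lemma ofNatural_surjective (a : natSubmonoid) : ∃ n, a = ofNatural n := by
  obtain ⟨a, ha⟩ := a
  obtain ⟨n, hn⟩ := Int.eq_ofNat_of_zero_le ha
  exact ⟨n, Subtype.ext (Multiplicative.toAdd.injective hn)⟩

lemma ofNatural_injective : Function.Injective ofNatural := fun m n h => by
  have : (m : ℤ) = n := congrArg (fun x : natSubmonoid => (x : Multiplicative ℤ).toAdd) h
  exact_mod_cast this

lemma ofNatural_add (m n : ℕ) : ofNatural (m + n) = ofNatural m * ofNatural n :=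
  Subtype.ext (Multiplicative.toAdd.injective (Nat.cast_add m n))

lemma ofNatural_zero : ofNatural 0 = 1 := rfl

lemma ofNatural_eq_pow (n : ℕ) : ofNatural n = ofNatural 1 ^ n := by
  induction n with
  | zero => rfl
  | succ n ih => rw [ofNatural_add, ih, pow_succ]

lemma mLeL_ofNatural {m n : ℕ} : MLeL (ofNatural m) (ofNatural n) ↔ m ≤ n := by
  constructor
  · rintro ⟨c, hc⟩
    obtain ⟨k, rfl⟩ := ofNatural_surjective c
    rw [← ofNatural_add] at hc
    have := ofNatural_injective hc
    omega
  · intro h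
    exact ⟨ofNatural (n - m), by rw [← ofNatural_add, Nat.add_sub_cancel' h]⟩

lemma mLeL_iff_mLeR {M : Type*} [CommMonoid M] {a b : M} : MLeL a b ↔ MLeR a b := by
  simp only [MLeL, MLeR, mul_comm]

lemma isAtomElt_ofNatural {n : ℕ} : IsAtomElt (ofNatural n) ↔ n = 1 := by
  constructor
  · rintro ⟨h0, h⟩
    rw [← ofNatural_zero, ofNatural_injective.ne_iff] at h0
    have := h (ofNatural 1) (ofNatural (n - 1))
      (by rw [← ofNatural_add, Nat.add_sub_cancel' (by omega)])
    simp only [← ofNatural_zero, ofNatural_injective.eq_iff] at this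
    omega
  · rintro rfl
    refine ⟨by rw [← ofNatural_zero, ofNatural_injective.ne_iff]; omega, fun b c h => ?_⟩
    obtain ⟨k, rfl⟩ := ofNatural_surjective b
    obtain ⟨l, rfl⟩ := ofNatural_surjective c
    rw [← ofNatural_add] at h
    have := ofNatural_injective h
    simp only [← ofNatural_zero, ofNatural_injective.eq_iff]
    omega

lemma atomNorm_ofNatural (n : ℕ) : atomNorm (ofNatural n) = n := by
  refine le_antisymm (iSup₂_le fun l hl => ?_) ?_
  · have hrep : l = List.replicate l.length (ofNatural 1) := by
      refine List.eq_replicate_iff.2 ⟨rfl, fun b hb => ?_⟩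
      obtain ⟨k, rfl⟩ := ofNatural_surjective b
      rw [isAtomElt_ofNatural.1 (hl.1 _ hb)]
    have h := hl.2
    rw [hrep, List.prod_replicate, ← ofNatural_eq_pow] at h
    rw [ofNatural_injective h]
  · have := length_le_atomNorm (a := ofNatural n) (l := List.replicate n (ofNatural 1))
      (fun x hx => by rw [List.eq_of_mem_replicate hx]; exact isAtomElt_ofNatural.2 rfl)
      (by rw [List.prod_replicate, ← ofNatural_eq_pow])
    simpa using this

lemma closure_eq_top_of_ofNatural_one_mem {S : Set natSubmonoid} (hS : ofNatural 1 ∈ S) :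
    Submonoid.closure S = ⊤ := by
  refine eq_top_iff.2 fun a _ => ?_
  obtain ⟨n, rfl⟩ := ofNatural_surjective a
  rw [ofNatural_eq_pow]
  exact pow_mem (Submonoid.subset_closure hS) n

lemma isGarsideElement_ofNatural {n : ℕ} (hn : 1 ≤ n) : IsGarsideElement (ofNatural n) where
  balanced _ := mLeL_iff_mLeR
  generates := closure_eq_top_of_ofNatural_one_mem (mLeL_ofNatural.2 hn)

lemma hasMeetsAndJoins_natSubmonoid :
    HasMeetsAndJoins (MLeL : natSubmonoid → natSubmonoid → Prop) := by
  constructor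
  · intro a b
    obtain ⟨m, rfl⟩ := ofNatural_surjective a
    obtain ⟨n, rfl⟩ := ofNatural_surjective b
    refine ⟨ofNatural (min m n), mLeL_ofNatural.2 (min_le_left _ _),
      mLeL_ofNatural.2 (min_le_right _ _), fun c hcm hcn => ?_⟩
    obtain ⟨k, rfl⟩ := ofNatural_surjective c
    exact mLeL_ofNatural.2 (le_min (mLeL_ofNatural.1 hcm) (mLeL_ofNatural.1 hcn))
  · intro a b
    obtain ⟨m, rfl⟩ := ofNatural_surjective a
    obtain ⟨n, rfl⟩ := ofNatural_surjective b
    refine ⟨ofNatural (max m n), mLeL_ofNatural.2 (le_max_left _ _),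
      mLeL_ofNatural.2 (le_max_right _ _), fun c hcm hcn => ?_⟩
    obtain ⟨k, rfl⟩ := ofNatural_surjective c
    exact mLeL_ofNatural.2 (max_le (mLeL_ofNatural.1 hcm) (mLeL_ofNatural.1 hcn))

lemma isGarsideGroup_natSubmonoid : IsGarsideGroup natSubmonoid where
  garside :=
    { atomic :=
        { generates := closure_eq_top_of_ofNatural_one_mem (isAtomElt_ofNatural.2 rfl)
          norm_lt_top := fun a => by
            obtain ⟨n, rfl⟩ := ofNatural_surjective a
            rw [atomNorm_ofNatural]
            exact ENat.natCast_lt_top n }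
      fg := Monoid.fg_iff.2
        ⟨{ofNatural 1}, closure_eq_top_of_ofNatural_one_mem rfl, Set.finite_singleton _⟩
      left_cancel := fun _ _ _ h => mul_left_cancel h
      right_cancel := fun _ _ _ h => mul_right_cancel h
      lattice_L := hasMeetsAndJoins_natSubmonoid
      lattice_R := by
        have : (MLeR : natSubmonoid → natSubmonoid → Prop) = MLeL := by
          ext a b
          exact mLeL_iff_mLeR.symm
        rw [this]
        exact hasMeetsAndJoins_natSubmonoid
      exists_garside := ⟨_, isGarsideElement_ofNatural le_rfl⟩ }
  fractions g := by
    refine ⟨Multiplicative.ofAdd (max g.toAdd 0), le_max_right g.toAdd (0 : ℤ),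
      Multiplicative.ofAdd (max (-g.toAdd) 0), le_max_right (-g.toAdd) (0 : ℤ), ?_⟩
    refine Multiplicative.toAdd.injective ?_
    simp only [toAdd_mul, toAdd_inv, toAdd_ofAdd]
    omega

lemma leL_natSubmonoid {g h : Multiplicative ℤ} :
    LeL natSubmonoid g h ↔ g.toAdd ≤ h.toAdd := by
  rw [leL_iff]
  change (0 : ℤ) ≤ (g⁻¹ * h).toAdd ↔ _
  rw [toAdd_mul, toAdd_inv]
  omega

lemma inf_natSubmonoid {N : ℕ} (hN : 0 < N) (g : Multiplicative ℤ) :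
    inf natSubmonoid (ofNatural N : Multiplicative ℤ) g = g.toAdd / N := by
  have hset : {r : ℤ | LeL natSubmonoid ((ofNatural N : Multiplicative ℤ) ^ r) g}
      = Set.Iic (g.toAdd / N) := by
    ext r
    rw [Set.mem_ofPred_eq, leL_natSubmonoid, Set.mem_Iic, Int.le_ediv_iff_mul_le (by omega),
      toAdd_zpow, smul_eq_mul]
    rfl
  rw [inf, hset, csSup_Iic]

lemma infS_natSubmonoid {N : ℕ} (hN : 0 < N) (g : Multiplicative ℤ) :
    infS natSubmonoid (ofNatural N : Multiplicative ℤ) g = g.toAdd / N := by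
  simp [infS, isConj_iff_eq, inf_natSubmonoid hN]

lemma tInf_natSubmonoid {N : ℕ} (hN : 0 < N) (g : Multiplicative ℤ) :
    tInf natSubmonoid (ofNatural N : Multiplicative ℤ) g = g.toAdd / N := by
  have hne : ofNatural N ≠ 1 := by
    rw [← ofNatural_zero, ofNatural_injective.ne_iff]; omega
  -- Along exponents divisible by `N` the floor is exact, and the limit is known to exist, so this
  -- subsequence determines it.
  have h := (tendsto_tInf isGarsideGroup_natSubmonoid (isGarsideElement_ofNatural hN) hne g).comp
    (tendsto_id.const_mul_atTop' hN)
  refine tendsto_nhds_unique h (tendsto_const_nhds.congr' ?_)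
  filter_upwards [eventually_gt_atTop 0] with n hn
  have hN' : (N : ℤ) ≠ 0 := by omega
  have hn' : (n : ℝ) ≠ 0 := by exact_mod_cast hn.ne'
  simp only [Function.comp, id]
  rw [inf_natSubmonoid hN, toAdd_pow, nsmul_eq_mul, Nat.cast_mul, mul_assoc,
    Int.mul_ediv_cancel_left _ hN']
  push_cast
  field_simp

end Integers

end Garside
theorem corollary3p3 :
    (∀ (G : Type*) [Group G] (P : Submonoid G) (Δ : P) (N : ℕ),
      Garside.IsGarsideGroup P → Garside.IsGarsideElement Δ → Δ ≠ 1 →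
      Garside.atomNorm Δ = (N : ℕ∞) →
      ∀ g : G,
        Garside.InvariantsExist P (Δ : G) g ∧
        ((Garside.infS P (Δ : G) g : ℝ) ≤ Garside.tInf P (Δ : G) g ∧
          Garside.tInf P (Δ : G) g ≤ (Garside.infS P (Δ : G) g : ℝ) + 1 - 1 / (N : ℝ)) ∧
        ((Garside.supS P (Δ : G) g : ℝ) - 1 + 1 / (N : ℝ) ≤ Garside.tSup P (Δ : G) g ∧
          Garside.tSup P (Δ : G) g ≤ (Garside.supS P (Δ : G) g : ℝ)) ∧
        ((Garside.lenS P (Δ : G) g : ℝ) - 2 + 2 / (N : ℝ) ≤ Garside.tLen P (Δ : G) g ∧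
          Garside.tLen P (Δ : G) g ≤ (Garside.lenS P (Δ : G) g : ℝ))) ∧
    (∀ N : ℕ, 2 ≤ N →
      ∃ (G : Type) (_ : Group G) (P : Submonoid G) (Δ : P) (g : G),
        Garside.IsGarsideGroup P ∧ Garside.IsGarsideElement Δ ∧
        Garside.atomNorm Δ = (N : ℕ∞) ∧
        Garside.tInf P (Δ : G) g = (Garside.infS P (Δ : G) g : ℝ) + 1 - 1 / (N : ℝ)) := by
  constructor
  · intro G _ P Δ N hP hΔ hne hnorm g
    have hN : Garside.natNorm Δ = N := by rw [Garside.natNorm, hnorm, ENat.toNat_natCast]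
    have h1 := Garside.infS_le_tInf hP hΔ hne g
    have h2 := Garside.tInf_le_infS hP hΔ hne hN g
    have h3 := Garside.infS_le_tInf hP hΔ hne g⁻¹
    have h4 := Garside.tInf_le_infS hP hΔ hne hN g⁻¹
    have h5 : (2 : ℝ) / N = 1 / N + 1 / N := by ring
    refine ⟨Garside.invariantsExist hP hΔ hne g, ⟨h1, h2⟩, ?_, ?_⟩
    · rw [Garside.tSup_eq hP hΔ hne, Garside.supS_eq hP hΔ hne]
      push_cast
      constructor <;> linarith
    · rw [Garside.lenS, Garside.tLen_eq hP hΔ hne, Garside.supS_eq hP hΔ hne]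
      push_cast
      constructor <;> linarith
  · intro N hN
    have hN0 : 0 < N := by omega
    -- For `g = N - 1` the floor of `g / N` is `0`, while the limit is `(N - 1) / N = 1 - 1/N`.
    refine ⟨Multiplicative ℤ, inferInstance, Garside.natSubmonoid, Garside.ofNatural N,
      Multiplicative.ofAdd ((N : ℤ) - 1), Garside.isGarsideGroup_natSubmonoid,
      Garside.isGarsideElement_ofNatural hN0, Garside.atomNorm_ofNatural N, ?_⟩
    have hN' : (N : ℝ) ≠ 0 := by exact_mod_cast hN0.ne'
    rw [Garside.tInf_natSubmonoid hN0, Garside.infS_natSubmonoid hN0, toAdd_ofAdd,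
      Int.ediv_eq_zero_of_lt (by omega) (by omega)]
    push_cast
    field_simp
    ring
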